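/- For a real form $f$ of degree $4$ in $x,y,z$, let its real rank $\mathrm{rk}_{\mathbb R}(f)$ be the smallest $r$ for which there are real numbers $c_1,\dots,c_r$ and real linear forms $\ell_1,\dots,\ell_r$ in $x,y,z$ with $f=\sum_{i=1}^r c_i\ell_i^4$. For $a\in\mathbb R$ let $$f_a = a(x^4+y^4+z^4)+6(x^2y^2+x^2z^2+y^2z^2).$$ Then: - if $a>0$ and $a\neq 1$, then $\mathrm{rk}_{\mathbb R}(f_a)=6$; - if $a=1$, then $\mathrm{rk}_{\mathbb R}(f_a)=4$; - if $-3\le a\le 0$, then $\mathrm{rk}_{\mathbb R}(f_a)=7$. -/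

import Mathlib

noncomputable section

/-- The linear form `∑ j, v j * X j` with real coefficient vector `v`. -/
def linForm {n : ℕ} (v : Fin n → ℝ) : MvPolynomial (Fin n) ℝ :=
  ∑ j, MvPolynomial.C (v j) * MvPolynomial.X j

/-- `f` is a real linear combination of `r` `d`-th powers of real linear forms
(the coefficients may have either sign). -/
def IsSumOfRealPowers {n : ℕ} (d : ℕ) (f : MvPolynomial (Fin n) ℝ) (r : ℕ) : Prop :=
  ∃ (c : Fin r → ℝ) (v : Fin r → Fin n → ℝ),
    f = ∑ i, MvPolynomial.C (c i) * linForm (v i) ^ d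

/-- The real (symmetric) rank of a real form `f` of degree `d` in `n` variables, that is, its rank
with respect to the real Veronese variety: the least `r` such that `f` is a real linear
combination of `r` `d`-th powers of real linear forms. -/
def realRank {n : ℕ} (d : ℕ) (f : MvPolynomial (Fin n) ℝ) : ℕ :=
  sInf {r : ℕ | IsSumOfRealPowers d f r}

/-- The symmetric even ternary quartic
`a (x⁴ + y⁴ + z⁴) + 6 (x² y² + x² z² + y² z²)`, with `x = X 0`, `y = X 1`, `z = X 2`. -/
def evenQuartic (a : ℝ) : MvPolynomial (Fin 3) ℝ :=
  MvPolynomial.C a *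
      (MvPolynomial.X 0 ^ 4 + MvPolynomial.X 1 ^ 4 + MvPolynomial.X 2 ^ 4) +
    6 * (MvPolynomial.X 0 ^ 2 * MvPolynomial.X 1 ^ 2 +
      MvPolynomial.X 0 ^ 2 * MvPolynomial.X 2 ^ 2 +
      MvPolynomial.X 1 ^ 2 * MvPolynomial.X 2 ^ 2)

end

/-!
A decomposition `f = ∑ cᵢ ℓᵢ⁴` of a ternary quartic diagonalises its catalecticant form: if `q(vᵢ)`
is the value of a conic `q` at the coefficient vector of `ℓᵢ`, then `B(q, q') = ∑ cᵢ q(vᵢ) q'(vᵢ)`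
for all conics `q`, `q'` (`sum_conicEval_mul`). For `evenQuartic a` the form `B = catalecticant a` is
explicit; it is nondegenerate for `a ≠ 1, -2`, and positive definite on a space of dimension four
for `a > -2`. Conics vanishing at fewer than six points give the lower bounds `6` and, at
`a = 1`, `4`.

For `-3 ≤ a ≤ 0` six powers are not enough.
* If `-2 ≤ a ≤ 0`, at least four of the `cᵢ` are positive, so there is a line `n` through all the
  other points. Then `B(nμ, nμ) ≥ 0` for every line `μ`. But `μ ↦ B(nμ, nμ)` is, at `a = 0`, a
  quadratic form in three variables with determinant
  `-3 (∑_{i ≠ j} n_i⁴ n_j² - 6 n₀² n₁² n₂²) ≤ 0`, so it is not positive definite, and lowering `a`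
  only makes it smaller. The resulting nonzero conic `nμ` lies in the radical of `B`,
  which contains no product of two nonzero lines (`not_isSumOfRealPowers_of_neg_two_le`).
* If `-3 ≤ a < -2`, the six points are dual to a basis of the conics, and `1 / cᵢ` is the value
  of the inverse form of `B` at the `i`-th point. That value is nowhere positive, so all `cᵢ` are
  negative, whereas `B(xy, xy) = 1` (`not_isSumOfRealPowers_of_lt_neg_two`).

The upper bounds are explicit: seven powers come from `f_a = f_1 + (a - 1)(x⁴ + y⁴ + z⁴)`,
where `f_a` is `evenQuartic a`, six powers for `a ≥ 2` from the points `(0, 1, ±t)` and their cyclic shifts, and six powers for `0 < a ≤ 2`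
from the orbits of a point `(p, q, 1)` and a point `(s, u, 0)` under the rotation by a right angle
in the `xy`-plane, which have four and, up to sign, two elements.
-/

/-! ### Conics and the catalecticant form -/

/-- Value at `p` of the conic with coefficients `q` on `x²`, `y²`, `z²`, `xy`, `xz`, `yz`, as a linear
functional of `q`. -/
def conicEval (p : Fin 3 → ℝ) : (Fin 6 → ℝ) →ₗ[ℝ] ℝ where
  toFun q := q 0 * p 0 ^ 2 + q 1 * p 1 ^ 2 + q 2 * p 2 ^ 2 + q 3 * (p 0 * p 1) +
    q 4 * (p 0 * p 2) + q 5 * (p 1 * p 2)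
  map_add' q q' := by simp only [Pi.add_apply]; ring
  map_smul' t q := by simp only [Pi.smul_apply, smul_eq_mul, RingHom.id_apply]; ring

lemma conicEval_apply (p : Fin 3 → ℝ) (q : Fin 6 → ℝ) :
    conicEval p q = q 0 * p 0 ^ 2 + q 1 * p 1 ^ 2 + q 2 * p 2 ^ 2 + q 3 * (p 0 * p 1) +
      q 4 * (p 0 * p 2) + q 5 * (p 1 * p 2) := rfl

/-- The catalecticant (middle apolar) bilinear form of `evenQuartic a` on conics, in the monomial
coefficients used by `conicEval`. -/
def catalecticant (a : ℝ) (q q' : Fin 6 → ℝ) : ℝ :=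
  a * (q 0 * q' 0 + q 1 * q' 1 + q 2 * q' 2) +
    (q 0 * (q' 1 + q' 2) + q 1 * (q' 0 + q' 2) + q 2 * (q' 0 + q' 1)) +
    (q 3 * q' 3 + q 4 * q' 4 + q 5 * q' 5)

/-- Coefficients of the conic that is the product of the lines `n` and `m`. -/
def lineMul (n m : Fin 3 → ℝ) : Fin 6 → ℝ :=
  ![n 0 * m 0, n 1 * m 1, n 2 * m 2, n 0 * m 1 + n 1 * m 0, n 0 * m 2 + n 2 * m 0,
    n 1 * m 2 + n 2 * m 1]

lemma conicEval_lineMul (p n m : Fin 3 → ℝ) :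
    conicEval p (lineMul n m) =
      (n 0 * p 0 + n 1 * p 1 + n 2 * p 2) * (m 0 * p 0 + m 1 * p 1 + m 2 * p 2) := by
  simp [conicEval_apply, lineMul]
  ring

/-- The conic `t (x² + y² + z²) + u xy + v xz + w yz`. -/
def roundConic : (Fin 4 → ℝ) →ₗ[ℝ] (Fin 6 → ℝ) where
  toFun u := ![u 0, u 0, u 0, u 1, u 2, u 3]
  map_add' u v := by ext i; fin_cases i <;> simp
  map_smul' t u := by ext i; fin_cases i <;> simp

lemma catalecticant_roundConic (a : ℝ) (u : Fin 4 → ℝ) :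
    catalecticant a (roundConic u) (roundConic u) =
      3 * (a + 2) * u 0 ^ 2 + u 1 ^ 2 + u 2 ^ 2 + u 3 ^ 2 := by
  simp [catalecticant, roundConic]
  ring

lemma eval_linForm (v x : Fin 3 → ℝ) :
    MvPolynomial.eval x (linForm v) = v 0 * x 0 + v 1 * x 1 + v 2 * x 2 := by
  simp [linForm, Fin.sum_univ_three]

lemma eval_evenQuartic (a : ℝ) (x : Fin 3 → ℝ) :
    MvPolynomial.eval x (evenQuartic a) = a * (x 0 ^ 4 + x 1 ^ 4 + x 2 ^ 4) +
      6 * (x 0 ^ 2 * x 1 ^ 2 + x 0 ^ 2 * x 2 ^ 2 + x 1 ^ 2 * x 2 ^ 2) := by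
  have h6 : MvPolynomial.eval x (6 : MvPolynomial (Fin 3) ℝ) = 6 := map_ofNat _ 6
  simp [evenQuartic, h6]

lemma isSumOfRealPowers_evenQuartic_of_eval {a : ℝ} {r : ℕ} (c : Fin r → ℝ)
    (v : Fin r → Fin 3 → ℝ)
    (h : ∀ x y z : ℝ, a * (x ^ 4 + y ^ 4 + z ^ 4) + 6 * (x ^ 2 * y ^ 2 + x ^ 2 * z ^ 2 + y ^ 2 * z ^ 2)
      = ∑ i, c i * (v i 0 * x + v i 1 * y + v i 2 * z) ^ 4) :
    IsSumOfRealPowers 4 (evenQuartic a) r := by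
  refine ⟨c, v, MvPolynomial.funext fun x => ?_⟩
  simp only [map_sum, map_mul, map_pow, eval_linForm, eval_evenQuartic, MvPolynomial.eval_C]
  exact h _ _ _

/-- A polynomial function `∑ cᵢ ℓᵢ⁴` determines the moments of order four of the weighted points. -/
lemma sum_conicEval_mul {a : ℝ} {r : ℕ} {c : Fin r → ℝ} {v : Fin r → Fin 3 → ℝ}
    (h : evenQuartic a = ∑ i, MvPolynomial.C (c i) * linForm (v i) ^ 4) (q q' : Fin 6 → ℝ) :
    ∑ i, c i * (conicEval (v i) q * conicEval (v i) q') = catalecticant a q q' := by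
  -- `M j k l` is the moment of `x ^ j * y ^ k * z ^ l`
  let M : ℕ → ℕ → ℕ → ℝ := fun j k l => ∑ i, c i * (v i 0 ^ j * v i 1 ^ k * v i 2 ^ l)
  have key : ∀ x y z : ℝ,
      a * (x ^ 4 + y ^ 4 + z ^ 4) + 6 * (x ^ 2 * y ^ 2 + x ^ 2 * z ^ 2 + y ^ 2 * z ^ 2) =
      M 4 0 0 * x ^ 4 + M 0 4 0 * y ^ 4 + M 0 0 4 * z ^ 4 +
      4 * (M 3 1 0 * (x ^ 3 * y) + M 3 0 1 * (x ^ 3 * z) + M 1 3 0 * (x * y ^ 3) +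
        M 0 3 1 * (y ^ 3 * z) + M 1 0 3 * (x * z ^ 3) + M 0 1 3 * (y * z ^ 3)) +
      6 * (M 2 2 0 * (x ^ 2 * y ^ 2) + M 2 0 2 * (x ^ 2 * z ^ 2) + M 0 2 2 * (y ^ 2 * z ^ 2)) +
      12 * (M 2 1 1 * (x ^ 2 * y * z) + M 1 2 1 * (x * y ^ 2 * z) +
        M 1 1 2 * (x * y * z ^ 2)) := by
    intro x y z
    have h1 := congrArg (MvPolynomial.eval ![x, y, z]) h
    simp only [map_sum, map_mul, map_pow, eval_linForm, eval_evenQuartic, MvPolynomial.eval_C,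
      Matrix.cons_val_zero, Matrix.cons_val_one, Matrix.cons_val] at h1
    rw [h1]
    simp only [M, Finset.sum_mul, Finset.mul_sum, ← Finset.sum_add_distrib]
    exact Finset.sum_congr rfl fun i _ => by ring
  have e400 : M 4 0 0 = a := by linarith [key 1 0 0]
  have e040 : M 0 4 0 = a := by linarith [key 0 1 0]
  have e004 : M 0 0 4 = a := by linarith [key 0 0 1]
  have e220 : M 2 2 0 = 1 := by linarith [key 1 1 0, key 1 (-1) 0]
  have e202 : M 2 0 2 = 1 := by linarith [key 1 0 1, key 1 0 (-1)]
  have e022 : M 0 2 2 = 1 := by linarith [key 0 1 1, key 0 1 (-1)]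
  have e310 : M 3 1 0 = 0 := by linarith [key 1 1 0, key 1 (-1) 0, key 2 1 0, key 2 (-1) 0]
  have e130 : M 1 3 0 = 0 := by linarith [key 1 1 0, key 1 (-1) 0, key 2 1 0, key 2 (-1) 0]
  have e301 : M 3 0 1 = 0 := by linarith [key 1 0 1, key 1 0 (-1), key 2 0 1, key 2 0 (-1)]
  have e103 : M 1 0 3 = 0 := by linarith [key 1 0 1, key 1 0 (-1), key 2 0 1, key 2 0 (-1)]
  have e031 : M 0 3 1 = 0 := by linarith [key 0 1 1, key 0 1 (-1), key 0 2 1, key 0 2 (-1)]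
  have e013 : M 0 1 3 = 0 := by linarith [key 0 1 1, key 0 1 (-1), key 0 2 1, key 0 2 (-1)]
  have k1 := key 1 1 1
  have k2 := key 1 1 (-1)
  have k3 := key 1 (-1) 1
  have k4 := key (-1) 1 1
  rw [e400, e040, e004, e220, e202, e022, e310, e130, e301, e103, e031, e013] at k1 k2 k3 k4
  have e211 : M 2 1 1 = 0 := by linarith
  have e121 : M 1 2 1 = 0 := by linarith
  have e112 : M 1 1 2 = 0 := by linarith
  have expand : ∑ i, c i * (conicEval (v i) q * conicEval (v i) q') =
      q 0 * q' 0 * M 4 0 0 + q 1 * q' 1 * M 0 4 0 + q 2 * q' 2 * M 0 0 4 +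
      (q 0 * q' 3 + q 3 * q' 0) * M 3 1 0 + (q 0 * q' 4 + q 4 * q' 0) * M 3 0 1 +
      (q 1 * q' 3 + q 3 * q' 1) * M 1 3 0 + (q 1 * q' 5 + q 5 * q' 1) * M 0 3 1 +
      (q 2 * q' 4 + q 4 * q' 2) * M 1 0 3 + (q 2 * q' 5 + q 5 * q' 2) * M 0 1 3 +
      (q 0 * q' 1 + q 1 * q' 0 + q 3 * q' 3) * M 2 2 0 +
      (q 0 * q' 2 + q 2 * q' 0 + q 4 * q' 4) * M 2 0 2 +
      (q 1 * q' 2 + q 2 * q' 1 + q 5 * q' 5) * M 0 2 2 +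
      (q 0 * q' 5 + q 5 * q' 0 + q 3 * q' 4 + q 4 * q' 3) * M 2 1 1 +
      (q 1 * q' 4 + q 4 * q' 1 + q 3 * q' 5 + q 5 * q' 3) * M 1 2 1 +
      (q 2 * q' 3 + q 3 * q' 2 + q 4 * q' 5 + q 5 * q' 4) * M 1 1 2 := by
    simp only [M, Finset.mul_sum, ← Finset.sum_add_distrib]
    exact Finset.sum_congr rfl fun i _ => by rw [conicEval_apply, conicEval_apply]; ring
  rw [expand, e400, e040, e004, e220, e202, e022, e310, e130, e301, e103, e031, e013, e211, e121,
    e112, catalecticant]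
  ring

/-- For `a ≠ 1`, the radical of the catalecticant form is contained in the span of
`x² + y² + z²`. -/
lemma eq_of_catalecticant_eq_zero {a : ℝ} (ha : a ≠ 1) {q : Fin 6 → ℝ}
    (h : ∀ q', catalecticant a q q' = 0) :
    q 1 = q 0 ∧ q 2 = q 0 ∧ q 3 = 0 ∧ q 4 = 0 ∧ q 5 = 0 := by
  have h0 := h ![1, 0, 0, 0, 0, 0]
  have h1 := h ![0, 1, 0, 0, 0, 0]
  have h2 := h ![0, 0, 1, 0, 0, 0]
  have h3 := h ![0, 0, 0, 1, 0, 0]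
  have h4 := h ![0, 0, 0, 0, 1, 0]
  have h5 := h ![0, 0, 0, 0, 0, 1]
  simp [catalecticant] at h0 h1 h2 h3 h4 h5
  have ha' : a - 1 ≠ 0 := sub_ne_zero.2 ha
  refine ⟨mul_left_cancel₀ ha' ?_, mul_left_cancel₀ ha' ?_, h3, h4, h5⟩ <;> linarith

lemma eq_zero_of_catalecticant_eq_zero {a : ℝ} (ha : a ≠ 1) (ha2 : a ≠ -2) {q : Fin 6 → ℝ}
    (h : ∀ q', catalecticant a q q' = 0) : q = 0 := by
  obtain ⟨h1, h2, h3, h4, h5⟩ := eq_of_catalecticant_eq_zero ha h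
  have h0 := h ![1, 0, 0, 0, 0, 0]
  simp [catalecticant, h1, h2] at h0
  have h0' : (a + 2) * q 0 = 0 := by linarith
  have : q 0 = 0 := (mul_eq_zero.1 h0').resolve_left fun h => ha2 (by linarith)
  ext i
  fin_cases i <;> simp [*]

/-! ### Lower bounds from the rank of the catalecticant form -/

lemma exists_ne_zero_forall_apply_eq_zero {ι : Type*} [Fintype ι] {k : ℕ}
    (φ : ι → (Fin k → ℝ) →ₗ[ℝ] ℝ) (h : Fintype.card ι < k) : ∃ u ≠ 0, ∀ i, φ i u = 0 := by
  have hk : LinearMap.ker (LinearMap.pi φ) ≠ ⊥ :=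
    LinearMap.ker_ne_bot_of_finrank_lt (by simpa using h)
  obtain ⟨u, hu, hu0⟩ := Submodule.exists_mem_ne_zero_of_ne_bot hk
  exact ⟨u, hu0, fun i => congrFun (LinearMap.mem_ker.1 hu) i⟩

lemma six_le_of_isSumOfRealPowers {a : ℝ} (ha : a ≠ 1) (ha2 : a ≠ -2) {r : ℕ}
    (h : IsSumOfRealPowers 4 (evenQuartic a) r) : 6 ≤ r := by
  obtain ⟨c, v, h⟩ := h
  by_contra! hr
  obtain ⟨q, hq0, hq⟩ := exists_ne_zero_forall_apply_eq_zero (fun i => conicEval (v i))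
    (by simpa using hr)
  refine hq0 (eq_zero_of_catalecticant_eq_zero ha ha2 fun q' => ?_)
  simp [← sum_conicEval_mul h, hq]

lemma four_le_of_isSumOfRealPowers_one {r : ℕ}
    (h : IsSumOfRealPowers 4 (evenQuartic 1) r) : 4 ≤ r := by
  obtain ⟨c, v, h⟩ := h
  by_contra! hr
  obtain ⟨u, hu0, hu⟩ := exists_ne_zero_forall_apply_eq_zero
    (fun i => conicEval (v i) ∘ₗ roundConic) (by simpa using hr)
  have hB := sum_conicEval_mul h (roundConic u) (roundConic u)
  simp only [LinearMap.comp_apply] at hu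
  simp only [hu, mul_zero, Finset.sum_const_zero, catalecticant_roundConic] at hB
  refine hu0 (funext fun i => ?_)
  fin_cases i <;> simp <;> nlinarith [sq_nonneg (u 0), sq_nonneg (u 1), sq_nonneg (u 2),
    sq_nonneg (u 3)]

/-! ### Six powers are not enough for `-3 ≤ a ≤ 0` -/

/-- For `a ≥ -2` the catalecticant form has four nonnegative directions, which bounds the number of
positive coefficients from below. -/
lemma four_le_card_pos {a : ℝ} (ha : -2 ≤ a) {r : ℕ} {c : Fin r → ℝ} {v : Fin r → Fin 3 → ℝ}
    (h : evenQuartic a = ∑ i, MvPolynomial.C (c i) * linForm (v i) ^ 4) :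
    4 ≤ Fintype.card {i // 0 < c i} := by
  by_contra! hlt
  obtain ⟨u, hu0, hu⟩ := exists_ne_zero_forall_apply_eq_zero
    (fun i : {i // 0 < c i} => conicEval (v i) ∘ₗ roundConic) hlt
  simp only [LinearMap.comp_apply, Subtype.forall] at hu
  have hB := sum_conicEval_mul h (roundConic u) (roundConic u)
  have hle : ∑ i, c i * (conicEval (v i) (roundConic u) * conicEval (v i) (roundConic u)) ≤ 0 := by
    refine Finset.sum_nonpos fun i _ => ?_
    by_cases hi : 0 < c i
    · simp [hu i hi]
    · exact mul_nonpos_of_nonpos_of_nonneg (not_lt.1 hi) (mul_self_nonneg _)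
  rw [hB, catalecticant_roundConic] at hle
  have hα : 0 ≤ 3 * (a + 2) * u 0 ^ 2 := by
    have : 0 ≤ a + 2 := by linarith
    positivity
  have h1 : u 1 = 0 := by nlinarith [sq_nonneg (u 1), sq_nonneg (u 2), sq_nonneg (u 3)]
  have h2 : u 2 = 0 := by nlinarith [sq_nonneg (u 1), sq_nonneg (u 2), sq_nonneg (u 3)]
  have h3 : u 3 = 0 := by nlinarith [sq_nonneg (u 1), sq_nonneg (u 2), sq_nonneg (u 3)]
  have h0 : u 0 ≠ 0 := fun h0 => hu0 (by ext i; fin_cases i <;> simp [*])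
  -- the conic is a multiple of `x² + y² + z²`, so the points of positive weight are all zero
  have hB2 := sum_conicEval_mul h ![0, 0, 0, 1, 0, 0] ![0, 0, 0, 1, 0, 0]
  have hle2 : ∑ i, c i * (conicEval (v i) ![0, 0, 0, 1, 0, 0] *
      conicEval (v i) ![0, 0, 0, 1, 0, 0]) ≤ 0 := by
    refine Finset.sum_nonpos fun i _ => ?_
    by_cases hi : 0 < c i
    · have hz := hu i hi
      simp only [conicEval_apply, roundConic, LinearMap.coe_mk, AddHom.coe_mk, h1, h2, h3,
        Matrix.cons_val, zero_mul, add_zero] at hz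
      have hz' : u 0 * (v i 0 ^ 2 + v i 1 ^ 2 + v i 2 ^ 2) = 0 := by linarith
      have hs := (mul_eq_zero.1 hz').resolve_left h0
      have : v i 0 = 0 := by nlinarith [sq_nonneg (v i 0), sq_nonneg (v i 1), sq_nonneg (v i 2)]
      simp [conicEval_apply, this]
    · exact mul_nonpos_of_nonpos_of_nonneg (not_lt.1 hi) (mul_self_nonneg _)
  rw [hB2] at hle2
  simp [catalecticant] at hle2
  linarith

/-- The radical of the catalecticant form contains no nonzero product of two lines, not even for
`a = -2`, where it is spanned by the irreducible conic `x² + y² + z²`. -/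
lemma lineMul_not_radical {a : ℝ} (ha : a ≠ 1) {n m : Fin 3 → ℝ} (hn : n ≠ 0) (hm : m ≠ 0) :
    ¬ ∀ q', catalecticant a (lineMul n m) q' = 0 := by
  intro h
  obtain ⟨h1, h2, h3, h4, h5⟩ := eq_of_catalecticant_eq_zero ha h
  simp [lineMul] at h1 h2 h3 h4 h5
  have h0 : n 0 * m 0 = 0 := by
    have : (n 0 * m 0) ^ 2 = -(n 0 * m 1) ^ 2 := by
      calc (n 0 * m 0) ^ 2 = (n 0 * m 0) * (n 1 * m 1) := by rw [h1]; ring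
        _ = (n 0 * m 1) * (n 1 * m 0) := by ring
        _ = -(n 0 * m 1) ^ 2 := by rw [eq_neg_of_add_eq_zero_right h3]; ring
    nlinarith [sq_nonneg (n 0 * m 0), sq_nonneg (n 0 * m 1)]
  rw [h0] at h1 h2
  obtain ⟨k, hk⟩ := Function.ne_iff.1 hn
  refine hm (funext fun j => ?_)
  fin_cases k <;> simp at hk <;> simp_all <;> fin_cases j <;> simp_all

/-- The Gram matrix of `μ ↦ B₀(nμ, nμ)`, where `B₀` is the catalecticant form at `a = 0`. -/
def lineGram (n : Fin 3 → ℝ) : Matrix (Fin 3) (Fin 3) ℝ :=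
  !![n 1 ^ 2 + n 2 ^ 2, 2 * (n 0 * n 1), 2 * (n 0 * n 2);
     2 * (n 0 * n 1), n 0 ^ 2 + n 2 ^ 2, 2 * (n 1 * n 2);
     2 * (n 0 * n 2), 2 * (n 1 * n 2), n 0 ^ 2 + n 1 ^ 2]

lemma det_lineGram_nonpos (n : Fin 3 → ℝ) : (lineGram n).det ≤ 0 := by
  have : (lineGram n).det = -3 * ((n 0 * (n 1 ^ 2 - n 2 ^ 2)) ^ 2 +
      (n 1 * (n 0 ^ 2 - n 2 ^ 2)) ^ 2 + (n 2 * (n 0 ^ 2 - n 1 ^ 2)) ^ 2) := by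
    simp [lineGram, Matrix.det_fin_three]
    ring
  rw [this]
  have : 0 ≤ (n 0 * (n 1 ^ 2 - n 2 ^ 2)) ^ 2 +
      (n 1 * (n 0 ^ 2 - n 2 ^ 2)) ^ 2 + (n 2 * (n 0 ^ 2 - n 1 ^ 2)) ^ 2 := by positivity
  linarith

lemma exists_catalecticant_lineMul_nonpos {a : ℝ} (ha : a ≤ 0) (n : Fin 3 → ℝ) :
    ∃ m ≠ 0, catalecticant a (lineMul n m) (lineMul n m) ≤ 0 := by
  have hnot : ¬ (lineGram n).PosDef := fun h => absurd h.det_pos (not_lt.2 (det_lineGram_nonpos n))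
  have hherm : (lineGram n).IsHermitian := by
    ext i j
    fin_cases i <;> fin_cases j <;> simp [lineGram]
  have : ∃ m ≠ 0, m ⬝ᵥ (lineGram n).mulVec m ≤ 0 := by
    by_contra! hpos
    exact hnot (Matrix.PosDef.of_dotProduct_mulVec_pos hherm fun m hm => by simpa using hpos m hm)
  obtain ⟨m, hm0, hm⟩ := this
  refine ⟨m, hm0, ?_⟩
  have heq : catalecticant a (lineMul n m) (lineMul n m) = m ⬝ᵥ (lineGram n).mulVec m +
      a * ((n 0 * m 0) ^ 2 + (n 1 * m 1) ^ 2 + (n 2 * m 2) ^ 2) := by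
    simp [catalecticant, lineMul, lineGram, Matrix.mulVec, dotProduct, Fin.sum_univ_three]
    ring
  rw [heq]
  have := mul_nonpos_of_nonpos_of_nonneg ha
    (by positivity : 0 ≤ (n 0 * m 0) ^ 2 + (n 1 * m 1) ^ 2 + (n 2 * m 2) ^ 2)
  linarith

lemma not_isSumOfRealPowers_of_neg_two_le {a : ℝ} (ha2 : -2 ≤ a) (ha : a ≤ 0) {r : ℕ}
    (hr : r ≤ 6) : ¬ IsSumOfRealPowers 4 (evenQuartic a) r := by
  rintro ⟨c, v, h⟩
  have hcard : Fintype.card {i // ¬ 0 < c i} < 3 := by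
    have h4 := four_le_card_pos ha2 h
    rw [Fintype.card_subtype_compl, Fintype.card_fin]
    omega
  -- a line through all points of nonpositive weight
  obtain ⟨n, hn0, hn⟩ := exists_ne_zero_forall_apply_eq_zero
    (fun i : {i // ¬ 0 < c i} => ∑ j, v i j • LinearMap.proj (R := ℝ) (φ := fun _ => ℝ) j) hcard
  obtain ⟨m, hm0, hm⟩ := exists_catalecticant_lineMul_nonpos ha n
  have hzero : ∀ i, ¬ 0 < c i → conicEval (v i) (lineMul n m) = 0 := by
    intro i hi
    have := hn ⟨i, hi⟩
    simp [Fin.sum_univ_three] at this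
    rw [conicEval_lineMul]
    exact mul_eq_zero_of_left (by linarith) _
  have hnonneg : ∀ i ∈ Finset.univ,
      0 ≤ c i * (conicEval (v i) (lineMul n m) * conicEval (v i) (lineMul n m)) := by
    intro i _
    by_cases hi : 0 < c i
    · exact mul_nonneg hi.le (mul_self_nonneg _)
    · simp [hzero i hi]
  have hsum : ∑ i, c i * (conicEval (v i) (lineMul n m) * conicEval (v i) (lineMul n m)) = 0 :=
    le_antisymm (by rwa [sum_conicEval_mul h]) (Finset.sum_nonneg hnonneg)
  have hall : ∀ i, conicEval (v i) (lineMul n m) = 0 := by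
    intro i
    by_cases hi : 0 < c i
    · have := (Finset.sum_eq_zero_iff_of_nonneg hnonneg).1 hsum i (Finset.mem_univ i)
      simpa [hi.ne'] using this
    · exact hzero i hi
  refine lineMul_not_radical (a := a) (by linarith) hn0 hm0 fun q' => ?_
  simp [← sum_conicEval_mul h, hall]

/-- The conic that represents `(a - 1)(a + 2)` times the evaluation at `l` with respect to the
catalecticant form. -/
def polarConic (a : ℝ) (l : Fin 3 → ℝ) : Fin 6 → ℝ :=
  ![(a + 2) * l 0 ^ 2 - (l 0 ^ 2 + l 1 ^ 2 + l 2 ^ 2),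
    (a + 2) * l 1 ^ 2 - (l 0 ^ 2 + l 1 ^ 2 + l 2 ^ 2),
    (a + 2) * l 2 ^ 2 - (l 0 ^ 2 + l 1 ^ 2 + l 2 ^ 2),
    (a - 1) * (a + 2) * (l 0 * l 1), (a - 1) * (a + 2) * (l 0 * l 2),
    (a - 1) * (a + 2) * (l 1 * l 2)]

lemma catalecticant_polarConic (a : ℝ) (l : Fin 3 → ℝ) (q : Fin 6 → ℝ) :
    catalecticant a (polarConic a l) q = (a - 1) * (a + 2) * conicEval l q := by
  simp [catalecticant, polarConic, conicEval_apply]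
  ring

lemma conicEval_polarConic_nonpos {a : ℝ} (ha3 : -3 ≤ a) (ha2 : a < -2) (l : Fin 3 → ℝ) :
    conicEval l (polarConic a l) ≤ 0 := by
  have heq : conicEval l (polarConic a l) =
      (a + 3) * (a - 1) / 3 * (l 0 ^ 2 + l 1 ^ 2 + l 2 ^ 2) ^ 2 -
      (a - 3) * (a + 2) / 6 * ((l 0 ^ 2 - l 1 ^ 2) ^ 2 + (l 0 ^ 2 - l 2 ^ 2) ^ 2 +
        (l 1 ^ 2 - l 2 ^ 2) ^ 2) := by
    simp [conicEval_apply, polarConic]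
    ring
  have h1 : (a + 3) * (a - 1) ≤ 0 :=
    mul_nonpos_of_nonneg_of_nonpos (by linarith) (by linarith)
  have h2 : 0 ≤ (a - 3) * (a + 2) := mul_nonneg_of_nonpos_of_nonpos (by linarith) (by linarith)
  have h3 := mul_nonpos_of_nonpos_of_nonneg h1 (sq_nonneg (l 0 ^ 2 + l 1 ^ 2 + l 2 ^ 2))
  have h4 := mul_nonneg h2 (by positivity : 0 ≤ (l 0 ^ 2 - l 1 ^ 2) ^ 2 +
    (l 0 ^ 2 - l 2 ^ 2) ^ 2 + (l 1 ^ 2 - l 2 ^ 2) ^ 2)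
  rw [heq]
  linarith

lemma not_isSumOfRealPowers_of_lt_neg_two {a : ℝ} (ha3 : -3 ≤ a) (ha2 : a < -2) :
    ¬ IsSumOfRealPowers 4 (evenQuartic a) 6 := by
  rintro ⟨c, v, h⟩
  have hinj : Function.Injective (LinearMap.pi fun i => conicEval (v i)) := by
    rw [← LinearMap.ker_eq_bot, LinearMap.ker_eq_bot']
    intro q hq
    refine eq_zero_of_catalecticant_eq_zero (a := a) (by linarith) (by linarith) fun q' => ?_
    have : ∀ i, conicEval (v i) q = 0 := fun i => congrFun hq i
    simp [← sum_conicEval_mul h, this]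
  have hsurj := LinearMap.injective_iff_surjective.1 hinj
  have hneg : ∀ i, c i ≤ 0 := by
    intro i
    -- `w` takes the value `1` at the `i`-th point and vanishes at the other ones
    obtain ⟨w, hw⟩ := hsurj (Pi.single i 1)
    have hw' : ∀ j, conicEval (v j) w = (Pi.single i 1 : Fin 6 → ℝ) j := fun j => congrFun hw j
    have hB := sum_conicEval_mul h (polarConic a (v i)) w
    rw [catalecticant_polarConic] at hB
    simp only [hw', Pi.single_apply, mul_ite, mul_one, mul_zero, Finset.sum_ite_eq',
      Finset.mem_univ, if_true] at hB
    have hpos : 0 < (a - 1) * (a + 2) := mul_pos_of_neg_of_neg (by linarith) (by linarith)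
    by_contra! hc
    nlinarith [mul_nonpos_of_nonneg_of_nonpos hc.le (conicEval_polarConic_nonpos ha3 ha2 (v i))]
  have hB := sum_conicEval_mul h ![0, 0, 0, 1, 0, 0] ![0, 0, 0, 1, 0, 0]
  have hle : ∑ i, c i * (conicEval (v i) ![0, 0, 0, 1, 0, 0] *
      conicEval (v i) ![0, 0, 0, 1, 0, 0]) ≤ 0 :=
    Finset.sum_nonpos fun i _ => mul_nonpos_of_nonpos_of_nonneg (hneg i) (mul_self_nonneg _)
  rw [hB] at hle
  simp [catalecticant] at hle
  linarith

/-! ### Explicit decompositions -/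

lemma isSumOfRealPowers_one : IsSumOfRealPowers 4 (evenQuartic 1) 4 := by
  refine isSumOfRealPowers_evenQuartic_of_eval (fun _ => 1 / 4)
    ![![1, 1, 1], ![1, 1, -1], ![1, -1, 1], ![1, -1, -1]] fun x y z => ?_
  simp [Fin.sum_univ_succ]
  ring

lemma isSumOfRealPowers_seven (a : ℝ) : IsSumOfRealPowers 4 (evenQuartic a) 7 := by
  refine isSumOfRealPowers_evenQuartic_of_eval
    ![1 / 4, 1 / 4, 1 / 4, 1 / 4, a - 1, a - 1, a - 1]
    ![![1, 1, 1], ![1, 1, -1], ![1, -1, 1], ![1, -1, -1], ![1, 0, 0], ![0, 1, 0], ![0, 0, 1]]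
    fun x y z => ?_
  simp [Fin.sum_univ_succ]
  ring

lemma isSumOfRealPowers_six_of_two_le {a : ℝ} (ha : 2 ≤ a) :
    IsSumOfRealPowers 4 (evenQuartic a) 6 := by
  -- `t² + 1 / t² = a`
  obtain ⟨t, ht0, ht⟩ : ∃ t : ℝ, t ≠ 0 ∧ t ^ 4 + 1 = a * t ^ 2 := by
    have h1 : 0 ≤ a ^ 2 - 4 := by nlinarith
    have h2 : 0 < (a + √(a ^ 2 - 4)) / 2 := by positivity
    refine ⟨√((a + √(a ^ 2 - 4)) / 2), (Real.sqrt_pos.2 h2).ne', ?_⟩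
    rw [show ∀ s : ℝ, s ^ 4 = (s ^ 2) ^ 2 by intro s; ring, Real.sq_sqrt h2.le]
    nlinarith [Real.sq_sqrt h1]
  have ha' : a = (t ^ 4 + 1) / t ^ 2 := by field_simp; linarith
  refine isSumOfRealPowers_evenQuartic_of_eval (fun _ => 1 / (2 * t ^ 2))
    ![![0, 1, t], ![0, 1, -t], ![t, 0, 1], ![-t, 0, 1], ![1, t, 0], ![1, -t, 0]] fun x y z => ?_
  simp [Fin.sum_univ_succ]
  rw [ha']
  field_simp
  ring

/-- A point of the unit circle has a fourth root on the unit circle, written in real and imaginary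
parts. -/
lemma exists_fourth_root_unit {x y : ℝ} (h : x ^ 2 + y ^ 2 = 1) :
    ∃ p q : ℝ, p ^ 2 + q ^ 2 = 1 ∧ p ^ 4 - 6 * p ^ 2 * q ^ 2 + q ^ 4 = x ∧
      4 * (p ^ 3 * q - p * q ^ 3) = y := by
  obtain ⟨w, hw⟩ := IsAlgClosed.exists_pow_nat_eq (⟨x, y⟩ : ℂ) (n := 4) (by norm_num)
  have hre := congrArg Complex.re hw
  have him := congrArg Complex.im hw
  simp [pow_succ] at hre him
  have hx : w.re ^ 4 - 6 * w.re ^ 2 * w.im ^ 2 + w.im ^ 4 = x := by rw [← hre]; ring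
  have hy : 4 * (w.re ^ 3 * w.im - w.re * w.im ^ 3) = y := by rw [← him]; ring
  refine ⟨w.re, w.im, ?_, hx, hy⟩
  have h4 : (w.re ^ 2 + w.im ^ 2) ^ 4 = 1 := by
    rw [← h, ← hx, ← hy]; ring
  exact (pow_eq_one_iff_of_nonneg (by positivity) (by norm_num)).1 h4

lemma isSumOfRealPowers_six_of_le_two {a : ℝ} (ha0 : 0 < a) (ha1 : a ≠ 1) (ha2 : a ≤ 2) :
    IsSumOfRealPowers 4 (evenQuartic a) 6 := by
  -- With `K = (a + 2)(a - 1)`, matching the fourth harmonics in the `xy`-plane amounts to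
  -- `2 exp(iα) + K exp(iβ) = a (a - 3)`. The triangle with these side lengths exists, and
  -- `x = cos α`, `y = sin α`, `x' = cos β`, `y' = sin β` are given by the law of cosines.
  have h3 : a - 3 ≠ 0 := by linarith
  have hK2 : a + 2 ≠ 0 := by linarith
  have hK1 : a - 1 ≠ 0 := sub_ne_zero.2 ha1
  set x := (1 + 3 * a - 2 * a ^ 2) / (a - 3) with hx
  have hx3 : x * (a - 3) = 1 + 3 * a - 2 * a ^ 2 := by rw [hx]; field_simp
  have hx1 : 0 ≤ 1 - x ^ 2 := by
    have h : 1 - x ^ 2 = (2 * (a - 1) ^ 2) * (2 * (a + 1) * (2 - a)) / (a - 3) ^ 2 := by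
      rw [hx]; field_simp; ring
    rw [h]
    have : 0 ≤ 2 - a := by linarith
    positivity
  set y := √(1 - x ^ 2) with hy
  have hy2 : y ^ 2 = 1 - x ^ 2 := Real.sq_sqrt hx1
  obtain ⟨p, q, hpq1, hpqx, hpqy⟩ := exists_fourth_root_unit (x := x) (y := y) (by linarith)
  set x' := (a * (a - 3) - 2 * x) / ((a + 2) * (a - 1)) with hx'
  set y' := -2 * y / ((a + 2) * (a - 1)) with hy'
  have hxy' : x' ^ 2 + y' ^ 2 = 1 := by
    rw [hx', hy', div_pow, div_pow, ← add_div, mul_pow (-2), hy2, div_eq_one_iff_eq (by positivity)]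
    linear_combination (-4 * a) * hx3
  obtain ⟨s, u, hsu1, hsux, hsuy⟩ := exists_fourth_root_unit hxy'
  have eK : (a + 2) * (a - 1) * x' = a * (a - 3) - 2 * x := by rw [hx']; field_simp
  have eK' : (a + 2) * (a - 1) * y' = -2 * y := by rw [hy']; field_simp
  clear_value x x' y y'
  set ρ := √(2 / a) with hρ
  have hρ2 : ρ ^ 2 = 2 / a := Real.sq_sqrt (by positivity)
  have hρ4 : ρ ^ 4 = 4 / a ^ 2 := by
    rw [show ρ ^ 4 = (ρ ^ 2) ^ 2 by ring, hρ2]; ring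
  refine isSumOfRealPowers_evenQuartic_of_eval
    ![a / 4, a / 4, a / 4, a / 4, (a + 2) * (a - 1) / a, (a + 2) * (a - 1) / a]
    ![![ρ * p, ρ * q, 1], ![-(ρ * q), ρ * p, 1], ![-(ρ * p), -(ρ * q), 1], ![ρ * q, -(ρ * p), 1],
      ![s, u, 0], ![-u, s, 0]] fun X Y Z => ?_
  -- the moments of the two orbits, in terms of the fourth harmonics
  have m4 : p ^ 4 + q ^ 4 = (3 + x) / 4 := by
    rw [← hpqx]
    linear_combination 3 / 4 * (p ^ 2 + q ^ 2 + 1) * hpq1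
  have m22 : p ^ 2 * q ^ 2 = (1 - x) / 8 := by
    rw [← hpqx]
    linear_combination 1 / 8 * (p ^ 2 + q ^ 2 + 1) * hpq1
  have n4 : s ^ 4 + u ^ 4 = (3 + x') / 4 := by
    rw [← hsux]
    linear_combination 3 / 4 * (s ^ 2 + u ^ 2 + 1) * hsu1
  have n22 : s ^ 2 * u ^ 2 = (1 - x') / 8 := by
    rw [← hsux]
    linear_combination 1 / 8 * (s ^ 2 + u ^ 2 + 1) * hsu1
  have f1 : a / 2 * (4 / a ^ 2) * ((3 + x) / 4) + (a + 2) * (a - 1) / a * ((3 + x') / 4) = a := by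
    field_simp
    linear_combination 2 * eK
  have f2 : a * (4 / a ^ 2) * ((1 - x) / 8) + 2 * ((a + 2) * (a - 1) / a) * ((1 - x') / 8) = 1 := by
    field_simp
    linear_combination -2 * eK
  have f3 : a / 2 * (4 / a ^ 2) * y + (a + 2) * (a - 1) / a * y' = 0 := by
    field_simp
    linear_combination 2 * eK'
  have f4 : a / 2 * (2 / a) * 1 = 1 := by field_simp
  calc _ = (a / 2 * ρ ^ 4 * (p ^ 4 + q ^ 4) + (a + 2) * (a - 1) / a * (s ^ 4 + u ^ 4)) *
          (X ^ 4 + Y ^ 4) + a * Z ^ 4 +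
        6 * (a * ρ ^ 4 * (p ^ 2 * q ^ 2) + 2 * ((a + 2) * (a - 1) / a) * (s ^ 2 * u ^ 2)) *
          (X ^ 2 * Y ^ 2) +
        6 * (a / 2 * ρ ^ 2 * (p ^ 2 + q ^ 2)) * (X ^ 2 * Z ^ 2 + Y ^ 2 * Z ^ 2) +
        (a / 2 * ρ ^ 4 * (4 * (p ^ 3 * q - p * q ^ 3)) +
          (a + 2) * (a - 1) / a * (4 * (s ^ 3 * u - s * u ^ 3))) * (X ^ 3 * Y - X * Y ^ 3) := by
        rw [m4, m22, n4, n22, hpqy, hsuy, hpq1, hρ4, hρ2, f1, f2, f3, f4]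
        ring
    _ = _ := by
        simp [Fin.sum_univ_succ]
        ring

/-! ### The real rank -/

lemma realRank_eq_of_forall_le {n d : ℕ} {f : MvPolynomial (Fin n) ℝ} {k : ℕ}
    (h : IsSumOfRealPowers d f k) (hle : ∀ r, IsSumOfRealPowers d f r → k ≤ r) :
    realRank d f = k :=
  le_antisymm (Nat.sInf_le h) (le_csInf ⟨k, h⟩ hle)

theorem theorem5p3 (a : ℝ) :
    (0 < a → a ≠ 1 → realRank 4 (evenQuartic a) = 6) ∧
    (a = 1 → realRank 4 (evenQuartic a) = 4) ∧
    (-3 ≤ a → a ≤ 0 → realRank 4 (evenQuartic a) = 7) := by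
  refine ⟨fun h0 h1 => ?_, ?_, fun h3 h0 => ?_⟩
  · refine realRank_eq_of_forall_le ?_ fun r hr =>
      six_le_of_isSumOfRealPowers h1 (by linarith) hr
    rcases le_total a 2 with h2 | h2
    · exact isSumOfRealPowers_six_of_le_two h0 h1 h2
    · exact isSumOfRealPowers_six_of_two_le h2
  · rintro rfl
    exact realRank_eq_of_forall_le isSumOfRealPowers_one fun r => four_le_of_isSumOfRealPowers_one
  · refine realRank_eq_of_forall_le (isSumOfRealPowers_seven a) fun r hr => ?_
    by_contra! hlt
    rcases le_or_gt (-2) a with h2 | h2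
    · exact not_isSumOfRealPowers_of_neg_two_le h2 h0 (by omega) hr
    · have h6 := six_le_of_isSumOfRealPowers (by linarith) (by linarith) hr
      obtain rfl : r = 6 := by omega
      exact not_isSumOfRealPowers_of_lt_neg_two h3 h2 hr
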